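/- Let $M\ge 1$ and $L_R\ge M$, and let $\tau_R>0$. For $i=1,2$ consider the channel $\mathbf G_i=\mathbf C_{r,G_i}\mathbf W_{G_i}\mathbf C_{t,G}^T$, where $\mathbf W_{G_i}$ has i.i.d. $\mathcal{CN}(0,1)$ entries, observed through $\mathbf Y_i=\mathbf G_i\mathbf S_R+\mathbf N_i$ with training matrix $\mathbf S_R\in\mathbb C^{M\times L_R}$ and $\mathrm{vec}(\mathbf N_i)\sim\mathcal{CN}(\mathbf 0,\mathbf K_{q,i}\otimes\mathbf K_{r,i})$. Assume that $\mathbf Z_{t,G}=\mathbf C_{t,G}\mathbf C_{t,G}^H\in\mathbb C^{M\times M}$ is positive definite, that $\mathbf Z_{r,G_i}=\mathbf C_{r,G_i}\mathbf C_{r,G_i}^H\in\mathbb C^{N_i\times N_i}$, $i=1,2$, are positive semidefinite and not both zero, that $\mathbf K_{r,i}$ is positive definite, and that $\mathbf K_{q,i}=q_i\mathbf I$ with $q_i>0$. Let $\mathbf Z_{t,G}=\mathbf U_{t,G}\,\mathrm{diag}(\sigma_{t,G,m})\,\mathbf U_{t,G}^H$ be an eigendecomposition with unitary $\mathbf U_{t,G}$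 (eigenvalues in any order), and let $\mathbf Z_{r,G_i}=\mathbf U_{r,G_i}\,\mathrm{diag}(\sigma_{r,G_i,n})\,\mathbf U_{r,G_i}^H$, $\mathbf K_{r,i}=\mathbf U_{r,G_i}\,\mathrm{diag}(\delta_{r,i,n})\,\mathbf U_{r,G_i}^H$ with a common unitary $\mathbf U_{r,G_i}$. Put $\tilde\beta_{i,n}=\sigma_{r,G_i,n}/(\delta_{r,i,n}q_i)$, and write $\mathbf S^*$ for the entrywise conjugate of $\mathbf S$. Then the total mean-square error $\sum_{i=1}^2 e_i$ of LMMSE channel estimation, where $$e_i=\mathrm{Tr}\Big[(\mathbf C_{t,G}^H\mathbf C_{t,G}\otimes\mathbf C_{r,G_i}^H\mathbf C_{r,G_i})\big(\mathbf I+(\mathbf S_R^T\mathbf C_{t,G}\otimes\mathbf C_{r,G_i})^H(\mathbf K_{q,i}\otimes\mathbf K_{r,i})^{-1}(\mathbf S_R^T\mathbf C_{t,G}\otimes\mathbf C_{r,G_i})\big)^{-1}\Big],$$ equals $$f(\mathbf S_R)=\sum_{i=1}^2\sum_{n=1}^{N_i}\sigma_{r,G_i,n}\,\mathrm{Tr}\big[(\mathbf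 Z_{t,G}^{-1}+\tilde\beta_{i,n}\mathbf S_R^*\mathbf S_R^T)^{-1}\big],$$ and the minimization of $f(\mathbf S_R)$ subject to $\mathrm{Tr}(\mathbf S_R\mathbf S_R^H)\le\tau_R$ is solved as follows. Let $\Lambda=\max_m\sum_{i=1}^2\sum_{n=1}^{N_i}\sigma_{r,G_i,n}\tilde\beta_{i,n}\sigma_{t,G,m}^2$ and $$\varphi_m(x)=\sum_{i=1}^2\sum_{n=1}^{N_i}\frac{\sigma_{r,G_i,n}\tilde\beta_{i,n}\sigma_{t,G,m}^2}{(1+\tilde\beta_{i,n}\sigma_{t,G,m}x)^2}.$$ For each $\lambda\in(0,\Lambda)$ there are unique numbers $\sigma_{s,R,m}(\lambda)\ge 0$, $m=1,\dots,M$, such that for every $m$ either $\sigma_{s,R,m}(\lambda)>0$ and $\lambda=\varphi_m(\sigma_{s,R,m}(\lambda))$, or $\sigma_{s,R,m}(\lambda)=0$ and $\varphi_m(0)\le\lambda$. The total power $P(\lambda)=\sum_m\sigma_{s,R,m}(\lambda)$ is strictly decreasing on $(0,\Lambda)$, and there is $\lambda\in(0,\Lambda)$ with $P(\lambda)=\tau_R$.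 This $\lambda$ is found by bisection: start with $[0,\Lambda]$ and, with $c$ the midpoint of the current interval, keep the right half if $P(c)>\tau_R$ and the left half otherwise; after $k$ steps the interval contains $\lambda$ and has length $\Lambda/2^k$. For this $\lambda$, with $\sigma_{s,R,m}=\sigma_{s,R,m}(\lambda)$, one has $\sigma_{s,R,m}\le\sigma_{s,R,m'}$ whenever $\sigma_{t,G,m}\le\sigma_{t,G,m'}$; and $\mathbf S_R$ is optimal if and only if $$\mathbf S_R=\mathbf U_{t,G}^*\,\mathbf\Sigma_{s,R}\,\mathbf V_{s,R}^T$$ for some unitary $\mathbf V_{s,R}\in\mathbb C^{L_R\times L_R}$, where $\mathbf\Sigma_{s,R}$ is the $M\times L_R$ diagonal matrix with entries $[\mathbf\Sigma_{s,R}]_{m,m}=\sqrt{\sigma_{s,R,m}}$. (Thus every unitary $\mathbf V_{s,R}$ gives an optimal training matrix, and there are no others.) -/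

import Mathlib

open scoped Kronecker Matrix ComplexOrder

noncomputable section

namespace RelayTraining

/-- Mean-square error of the LMMSE estimate of one relay-to-source channel
`G = C_r W C_tᵀ` (with `W` having i.i.d. `CN(0,1)` entries) from `Y = G S + N`,
where `vec N` has covariance `K`:
`Tr[(C_tᴴ C_t ⊗ C_rᴴ C_r) (I + (Sᵀ C_t ⊗ C_r)ᴴ K⁻¹ (Sᵀ C_t ⊗ C_r))⁻¹]`. -/
def linkMSE {M L N : ℕ} (Ct : Matrix (Fin M) (Fin M) ℂ) (Cr : Matrix (Fin N) (Fin N) ℂ)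
    (K : Matrix (Fin L × Fin N) (Fin L × Fin N) ℂ) (S : Matrix (Fin M) (Fin L) ℂ) : ℂ :=
  (((Ctᴴ * Ct) ⊗ₖ (Crᴴ * Cr)) *
    (1 + ((Sᵀ * Ct) ⊗ₖ Cr)ᴴ * K⁻¹ * ((Sᵀ * Ct) ⊗ₖ Cr))⁻¹).trace

/-- `β̃_{i,n} = σ_{r,i,n} / (δ_{r,i,n} q_i)`. -/
def betaTilde {N : Fin 2 → ℕ} (σr δ : (i : Fin 2) → Fin (N i) → ℝ) (q : Fin 2 → ℝ)
    (i : Fin 2) (n : Fin (N i)) : ℝ :=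
  σr i n / δ i n / q i

/-- The objective `∑ᵢ ∑ₙ σ_{r,i,n} Tr[(Z_t⁻¹ + β_{i,n} S* Sᵀ)⁻¹]`, where `S*` is the entrywise
conjugate of `S`. The traces are those of Hermitian matrices, hence real. -/
def objective {M L : ℕ} {N : Fin 2 → ℕ} (Zt : Matrix (Fin M) (Fin M) ℂ)
    (σr β : (i : Fin 2) → Fin (N i) → ℝ) (S : Matrix (Fin M) (Fin L) ℂ) : ℝ :=
  ∑ i, ∑ n, σr i n * ((Zt⁻¹ + (β i n : ℂ) • (S.map star * Sᵀ))⁻¹).trace.re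

/-- Transmit power `Tr(S Sᴴ)` of a training matrix. -/
def power {M L : ℕ} (S : Matrix (Fin M) (Fin L) ℂ) : ℝ := (S * Sᴴ).trace.re

/-- `S` minimizes `f` subject to the power constraint `Tr(S Sᴴ) ≤ τ`. -/
def IsOptimalTraining {M L : ℕ} (f : Matrix (Fin M) (Fin L) ℂ → ℝ) (τ : ℝ)
    (S : Matrix (Fin M) (Fin L) ℂ) : Prop :=
  power S ≤ τ ∧ ∀ T, power T ≤ τ → f S ≤ f T

/-- The `M × L` diagonal matrix with diagonal entries `√(s m)`. -/
def sqrtDiag {M : ℕ} (L : ℕ) (s : Fin M → ℝ) : Matrix (Fin M) (Fin L) ℂ :=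
  Matrix.of fun m l => if (m : ℕ) = (l : ℕ) then ((Real.sqrt (s m) : ℝ) : ℂ) else 0

/-- Right-hand side of the multiplier equation for the `m`-th eigendirection, at power `x`:
`∑ᵢ ∑ₙ σ_{r,i,n} β_{i,n} σ_{t,m}² / (1 + β_{i,n} σ_{t,m} x)²`. -/
def multiplierRHS {M : ℕ} {N : Fin 2 → ℕ} (σt : Fin M → ℝ)
    (σr β : (i : Fin 2) → Fin (N i) → ℝ) (m : Fin M) (x : ℝ) : ℝ :=
  ∑ i, ∑ n, σr i n * β i n * σt m ^ 2 / (1 + β i n * σt m * x) ^ 2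

/-- The upper end `max_m ∑ᵢ ∑ₙ σ_{r,i,n} β_{i,n} σ_{t,m}²` of the range of the multiplier. -/
def multiplierBound {M : ℕ} {N : Fin 2 → ℕ} (σt : Fin M → ℝ)
    (σr β : (i : Fin 2) → Fin (N i) → ℝ) : ℝ :=
  ⨆ m, ∑ i, ∑ n, σr i n * β i n * σt m ^ 2

/-- `s` is the power allocation obtained from the multiplier equation at `lam`: a direction
carrying power solves the equation, and a direction carries no power exactly when the equation
has no positive solution (its right-hand side at zero power does not exceed `lam`). -/
def IsAllocation {M : ℕ} {N : Fin 2 → ℕ} (σt : Fin M → ℝ)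
    (σr β : (i : Fin 2) → Fin (N i) → ℝ) (lam : ℝ) (s : Fin M → ℝ) : Prop :=
  ∀ m, (0 < s m ∧ lam = multiplierRHS σt σr β m (s m)) ∨
    (s m = 0 ∧ multiplierRHS σt σr β m 0 ≤ lam)

/-- Bisection for `P x = τ` with a decreasing `P`, started from the interval with ends `0` and
`top`: after `k` steps, the pair of ends of the current interval. -/
def bisection (P : ℝ → ℝ) (τ top : ℝ) : ℕ → ℝ × ℝ
  | 0 => (0, top)
  | k + 1 =>
    let I := bisection P τ top k
    let mid := (I.1 + I.2) / 2
    if τ < P mid then (mid, I.2) else (I.1, mid)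

end RelayTraining

end

/-! The error depends on the factors only through `Zt` and `Zr`, by the push-through identity. In
the common eigenbasis of `Zr` and `Kr` the Kronecker system splits into one `M × M` block per
receive eigenvalue, which gives the objective (`linkMSE_eq`).

For the minimization, put `Y = Utᴴ S*` and `X = Y Yᴴ`. Both objective and power depend on `X` alone,
the power being its trace. The objective is a sum of convex functions `Tr (D + β X)⁻¹`, bounded
below by their tangents at the candidate `diag s`. The error of a tangent at `B` is exactly `Tr (A⁻¹
- B⁻¹) A (A⁻¹ - B⁻¹)`, nonnegative and zero only for `A = B` (`re_trace_inv_gap`). As `B` is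
diagonal, the tangent sees only the diagonal of `X`, and the multiplier conditions give its slope
the right sign. So `diag s` is the unique optimal Gram matrix (`gramObjective_gap`), and the optimal
`S` are its factors `Y`, a fixed square root times a unitary (`mul_conjTranspose_eq_diagonal_iff`).

The multiplier itself comes from water-filling: the marginal returns are positive, continuous,
strictly decreasing and tend to zero, so the total power is continuous and monotone in the level and
takes the value `τ`. -/

namespace RelayTraining

/-! ### Water-filling for general decreasing marginal returns -/

section Waterfilling

variable {ι : Type*}

/-- `s` solves the water-filling conditions at level `lam` for the marginal returns `φ`. -/
def IsWaterfilling (φ : ι → ℝ → ℝ) (lam : ℝ) (s : ι → ℝ) : Prop :=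
  ∀ m, (0 < s m ∧ lam = φ m (s m)) ∨ (s m = 0 ∧ φ m 0 ≤ lam)

namespace IsWaterfilling

variable {φ : ι → ℝ → ℝ} {lam lam' : ℝ} {s s' : ι → ℝ}

lemma nonneg (h : IsWaterfilling φ lam s) (m : ι) : 0 ≤ s m := by
  rcases h m with h | h
  · exact h.1.le
  · exact h.1.ge

lemma apply_le (h : IsWaterfilling φ lam s) (m : ι) : φ m (s m) ≤ lam := by
  rcases h m with h | h
  · exact h.2.ge
  · rw [h.1]; exact h.2

lemma apply_eq_of_pos (h : IsWaterfilling φ lam s) {m : ι} (hm : 0 < s m) :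
    φ m (s m) = lam := by
  rcases h m with h | h
  · exact h.2.symm
  · exact absurd h.1 hm.ne'

lemma apply_mul (h : IsWaterfilling φ lam s) (m : ι) : φ m (s m) * s m = lam * s m := by
  rcases h m with h | h
  · rw [← h.2]
  · simp [h.1]

/-- Testing `φ m` at a point against the level locates `s m` relative to that point. Uniqueness,
monotonicity and continuity all reduce to this test and its two strict variants. -/
lemma le_of_apply_le (hφ : ∀ m, StrictAntiOn (φ m) (Set.Ici 0)) (h : IsWaterfilling φ lam s)
    {m : ι} {b : ℝ} (hb : 0 ≤ b) (hlam : φ m b ≤ lam) : s m ≤ b := by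
  by_contra! hlt
  have := hφ m hb (hb.trans hlt.le) hlt
  rw [h.apply_eq_of_pos (hb.trans_lt hlt)] at this
  exact this.not_ge hlam

lemma lt_of_apply_lt (hφ : ∀ m, StrictAntiOn (φ m) (Set.Ici 0)) (h : IsWaterfilling φ lam s)
    {m : ι} {b : ℝ} (hb : 0 < b) (hlam : φ m b < lam) : s m < b := by
  refine (h.le_of_apply_le hφ hb.le hlam.le).lt_of_ne fun he => ?_
  rw [← he, h.apply_eq_of_pos (he ▸ hb)] at hlam
  exact hlam.false

lemma lt_of_lt_apply (hφ : ∀ m, StrictAntiOn (φ m) (Set.Ici 0)) (h : IsWaterfilling φ lam s)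
    {m : ι} {a : ℝ} (ha : 0 ≤ a) (hlam : lam < φ m a) : a < s m := by
  by_contra! hle
  have := (hφ m).antitoneOn (h.nonneg m) ha hle
  linarith [h.apply_le m]

lemma anti (hφ : ∀ m, StrictAntiOn (φ m) (Set.Ici 0)) (h : IsWaterfilling φ lam s)
    (h' : IsWaterfilling φ lam' s') (hle : lam ≤ lam') (m : ι) : s' m ≤ s m :=
  h'.le_of_apply_le hφ (h.nonneg m) ((h.apply_le m).trans hle)

/-- The condition `lam < φ m 0` says that direction `m` is active at `lam`; an inactive one would
stay at zero. -/
lemma strictAnti (hφ : ∀ m, StrictAntiOn (φ m) (Set.Ici 0)) (h : IsWaterfilling φ lam s)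
    (h' : IsWaterfilling φ lam' s') (hlt : lam < lam') {m : ι} (hm : lam < φ m 0) :
    s' m < s m := by
  rcases h' m with h₁ | h₁
  · exact h.lt_of_lt_apply hφ h₁.1.le (h₁.2 ▸ hlt)
  · rw [h₁.1]; exact h.lt_of_lt_apply hφ le_rfl hm

lemma unique (hφ : ∀ m, StrictAntiOn (φ m) (Set.Ici 0)) (h : IsWaterfilling φ lam s)
    (h' : IsWaterfilling φ lam s') : s = s' :=
  funext fun m => le_antisymm (h'.anti hφ h le_rfl m) (h.anti hφ h' le_rfl m)

lemma le_of_forall_le (hφ : ∀ m, StrictAntiOn (φ m) (Set.Ici 0)) (h : IsWaterfilling φ lam s)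
    {m m' : ι} (hm : ∀ x, 0 ≤ x → φ m x ≤ φ m' x) : s m ≤ s m' :=
  h.le_of_apply_le hφ (h.nonneg m') ((hm _ (h.nonneg m')).trans (h.apply_le m'))

end IsWaterfilling

variable {φ : ι → ℝ → ℝ}

lemma exists_isWaterfilling (hc : ∀ m, ContinuousOn (φ m) (Set.Ici 0))
    (ht : ∀ m, Filter.Tendsto (φ m) Filter.atTop (nhds 0)) {lam : ℝ} (hlam : 0 < lam) :
    ∃ s, IsWaterfilling φ lam s := by
  suffices h : ∀ m, ∃ x : ℝ, (0 < x ∧ lam = φ m x) ∨ (x = 0 ∧ φ m 0 ≤ lam) by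
    choose s hs using h
    exact ⟨s, hs⟩
  intro m
  by_cases h0 : φ m 0 ≤ lam
  · exact ⟨0, Or.inr ⟨rfl, h0⟩⟩
  push Not at h0
  obtain ⟨b, hb, hb0⟩ := (((ht m).eventually_lt_const hlam).and
    (Filter.eventually_ge_atTop 0)).exists
  obtain ⟨x, hx, hxl⟩ := intermediate_value_Icc' hb0
    ((hc m).mono Set.Icc_subset_Ici_self) ⟨hb.le, h0.le⟩
  refine ⟨x, Or.inl ⟨hx.1.lt_of_ne ?_, hxl.symm⟩⟩
  rintro rfl
  exact h0.ne' hxl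

/-- Bounds on `s m` are certified by strict inequalities between `lam` and values of `φ m`, and
these survive small changes of `lam`. -/
lemma continuousAt_waterfilling (hφ : ∀ m, StrictAntiOn (φ m) (Set.Ici 0)) {p : ℝ → ι → ℝ}
    (hp : ∀ lam, 0 < lam → IsWaterfilling φ lam (p lam)) {lam : ℝ} (hlam : 0 < lam) (m : ι) :
    ContinuousAt (fun x => p x m) lam := by
  have hpos : ∀ᶠ x in nhds lam, 0 < x := eventually_gt_nhds hlam
  have h := hp lam hlam
  refine tendsto_order.2 ⟨fun a ha => ?_, fun b hb => ?_⟩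
  · rcases lt_or_ge a 0 with ha0 | ha0
    · filter_upwards [hpos] with x hx using ha0.trans_le ((hp x hx).nonneg m)
    · have hlt : lam < φ m a := by
        rw [← h.apply_eq_of_pos (ha0.trans_lt ha)]
        exact hφ m ha0 (h.nonneg m) ha
      filter_upwards [hpos, eventually_lt_nhds hlt] with x hx hxa
      exact (hp x hx).lt_of_lt_apply hφ ha0 hxa
  · have hb0 : 0 < b := (h.nonneg m).trans_lt hb
    have hlt : φ m b < lam := (hφ m (h.nonneg m) hb0.le hb).trans_le (h.apply_le m)
    filter_upwards [hpos, eventually_gt_nhds hlt] with x hx hxb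
    exact (hp x hx).lt_of_apply_lt hφ hb0 hxb

variable [Fintype ι] [Nonempty ι]

lemma exists_eq_iSup_apply_zero (φ : ι → ℝ → ℝ) : ∃ m, φ m 0 = ⨆ m, φ m 0 :=
  exists_eq_ciSup_of_finite (f := fun m => φ m 0)

lemma strictAntiOn_sum_waterfilling (hφ : ∀ m, StrictAntiOn (φ m) (Set.Ici 0)) {p : ℝ → ι → ℝ}
    (hp : ∀ lam, 0 < lam → IsWaterfilling φ lam (p lam)) :
    StrictAntiOn (fun lam => ∑ m, p lam m) (Set.Ioo 0 (⨆ m, φ m 0)) := by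
  intro x hx y hy hxy
  -- A direction maximizing `φ m 0` is active at every level below the supremum, which makes the sum
  -- strictly decreasing.
  obtain ⟨m, hm⟩ := exists_eq_iSup_apply_zero φ
  exact Finset.sum_lt_sum (fun m _ => (hp x hx.1).anti hφ (hp y hy.1) hxy.le m)
    ⟨m, Finset.mem_univ m, (hp x hx.1).strictAnti hφ (hp y hy.1) hxy (hm ▸ hx.2)⟩

lemma exists_sum_waterfilling_eq (hφ : ∀ m, StrictAntiOn (φ m) (Set.Ici 0))
    (hpos : ∀ m x, 0 ≤ x → 0 < φ m x) {p : ℝ → ι → ℝ}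
    (hp : ∀ lam, 0 < lam → IsWaterfilling φ lam (p lam)) {τ : ℝ} (hτ : 0 < τ) :
    ∃ lam ∈ Set.Ioo 0 (⨆ m, φ m 0), ∑ m, p lam m = τ := by
  obtain ⟨m₀, hm₀⟩ := exists_eq_iSup_apply_zero φ
  have hcard : (0 : ℝ) < Fintype.card ι := by exact_mod_cast Fintype.card_pos
  set t := τ / Fintype.card ι with ht
  have htpos : 0 < t := div_pos hτ hcard
  obtain ⟨m₁, hm₁⟩ := Finite.exists_max (fun m => φ m t)
  -- Two levels bracket `τ`: at `a` the direction `m₀` alone receives at least `τ`, while at `b` no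
  -- direction receives more than the equal share `t`.
  set a := φ m₀ τ with ha
  set b := φ m₁ t with hb
  have ha0 : 0 < a := hpos _ _ hτ.le
  have hb0 : 0 < b := hpos _ _ htpos.le
  have haΛ : a < ⨆ m, φ m 0 := hm₀ ▸ hφ m₀ Set.self_mem_Ici hτ.le hτ
  have hbΛ : b < ⨆ m, φ m 0 := (hφ m₁ Set.self_mem_Ici htpos.le htpos).trans_le
    (le_ciSup (f := fun m => φ m 0) (Set.finite_range _).bddAbove m₁)
  have hconn : IsPreconnected (Set.Ioo 0 (⨆ m, φ m 0)) := isPreconnected_Ioo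
  have hcont : ContinuousOn (fun x => ∑ m, p x m) (Set.Ioo 0 (⨆ m, φ m 0)) := 
    continuousOn_finsetSum _ fun m _ x hx =>
      (continuousAt_waterfilling hφ hp hx.1 m).continuousWithinAt
  obtain ⟨x, hx, hxτ⟩ := hconn.intermediate_value (a := b) (b := a) ⟨hb0, hbΛ⟩ ⟨ha0, haΛ⟩ hcont
    (show τ ∈ Set.Icc _ _ from by
      constructor
      · calc ∑ m, p b m ≤ ∑ _m : ι, t :=
              Finset.sum_le_sum fun m _ => (hp b hb0).le_of_apply_le hφ htpos.le (hm₁ m)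
          _ = τ := by simp [ht]; field_simp
      · refine le_trans ?_ (Finset.single_le_sum (fun m _ => (hp a ha0).nonneg m)
          (Finset.mem_univ m₀))
        by_contra! hlt
        have := hφ m₀ ((hp a ha0).nonneg m₀) hτ.le hlt
        exact this.not_ge ((hp a ha0).apply_le m₀))
  exact ⟨x, hx, hxτ⟩

end Waterfilling

/-! ### Correctness of bisection -/

/-- The bounds by `0` and `top` serve the induction: they keep each midpoint in the open interval
where `P` is strictly decreasing. -/
lemma bisection_spec {P : ℝ → ℝ} {τ top lam : ℝ} (hP : StrictAntiOn P (Set.Ioo 0 top))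
    (hlam : lam ∈ Set.Ioo 0 top) (hτ : P lam = τ) (k : ℕ) :
    0 ≤ (bisection P τ top k).1 ∧ (bisection P τ top k).2 ≤ top ∧
      (bisection P τ top k).1 ≤ lam ∧ lam ≤ (bisection P τ top k).2 ∧
      (bisection P τ top k).2 - (bisection P τ top k).1 = top / 2 ^ k := by
  induction k with
  | zero => simp [bisection, hlam.1.le, hlam.2.le]
  | succ k ih =>
    obtain ⟨h1, h2, h3, h4, h5⟩ := ih
    have hlen : 0 < top / 2 ^ k := div_pos (hlam.1.trans hlam.2) (by positivity)
    have hhalf : top / 2 ^ (k + 1) = top / 2 ^ k / 2 := by rw [pow_succ]; field_simp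
    simp only [bisection]
    set I := bisection P τ top k
    have hmid : (I.1 + I.2) / 2 ∈ Set.Ioo 0 top := ⟨by linarith, by linarith⟩
    rw [hhalf, ← h5]
    split_ifs with h
    · rw [← hτ, hP.lt_iff_gt hlam hmid] at h
      exact ⟨hmid.1.le, h2, h.le, h4, by ring⟩
    · rw [← hτ, not_lt, hP.le_iff_ge hmid hlam] at h
      exact ⟨h1, hmid.2.le, h3, h, by ring⟩

end RelayTraining

namespace RelayTraining

open Matrix

/-! ### Reduction of the mean-square error to the objective -/

section MSE

/-- Push-through identity `C (1 + Cᴴ Q C)⁻¹ Cᴴ = (1 + C Cᴴ Q)⁻¹ C Cᴴ` followed by cyclicity of the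
trace; `C` may be singular. Describing `R` by an equation lets it be verified blockwise. -/
lemma trace_gram_mul_inv {m : Type*} [Fintype m] [DecidableEq m] {C Q R : Matrix m m ℂ}
    (hQ : Q.PosSemidef) (hR : (1 + C * Cᴴ * Q) * R = C * Cᴴ) :
    (Cᴴ * C * (1 + Cᴴ * Q * C)⁻¹).trace = R.trace := by
  have hu : IsUnit (1 + Cᴴ * Q * C).det :=
    ((Matrix.isUnit_iff_isUnit_det _).1
      (PosDef.one.add_posSemidef (hQ.conjTranspose_mul_mul_same C)).isUnit)
  -- This matrix need not be Hermitian, so invertibility is carried over by Sylvester's determinant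
  -- identity.
  have hu' : IsUnit (1 + C * Cᴴ * Q).det := by
    rwa [Matrix.mul_assoc, det_one_add_mul_comm]
  set G := (1 + Cᴴ * Q * C)⁻¹ with hG
  have hR' : R = C * G * Cᴴ := by
    have h1 : (1 + C * Cᴴ * Q) * (C * G * Cᴴ) = C * Cᴴ := by
      calc (1 + C * Cᴴ * Q) * (C * G * Cᴴ) = C * ((1 + Cᴴ * Q * C) * G) * Cᴴ := by noncomm_ring
        _ = C * Cᴴ := by rw [hG, mul_nonsing_inv _ hu, Matrix.mul_one]
    have h2 := congrArg (fun B => (1 + C * Cᴴ * Q)⁻¹ * B) (hR.trans h1.symm)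
    simpa only [← Matrix.mul_assoc, nonsing_inv_mul _ hu', Matrix.one_mul] using h2
  rw [hR', trace_mul_cycle C G]

variable {M L N : ℕ} {Zt Ct : Matrix (Fin M) (Fin M) ℂ}

lemma posSemidef_map_star_mul_transpose (S : Matrix (Fin M) (Fin L) ℂ) :
    (S.map star * Sᵀ).PosSemidef :=
  posSemidef_conjTranspose_mul_self Sᵀ

lemma posDef_inv_add_smul (hZt : Zt.PosDef) {b : ℝ} (hb : 0 ≤ b) (S : Matrix (Fin M) (Fin L) ℂ) :
    (Zt⁻¹ + (b : ℂ) • (S.map star * Sᵀ)).PosDef :=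
  hZt.inv.add_posSemidef ((posSemidef_map_star_mul_transpose S).smul (by exact_mod_cast hb))

lemma PosDef.ofReal_re_trace {m : Type*} [Fintype m] {A : Matrix m m ℂ} (hA : A.PosDef) :
    ((A.trace.re : ℝ) : ℂ) = A.trace :=
  Complex.conj_eq_iff_re.1 (by
    rw [← Complex.star_def, ← trace_conjTranspose, hA.isHermitian.eq])

lemma linkMSE_eq (hZt : Zt.PosDef) (hCt : Ct * Ctᴴ = Zt)
    {Zr Cr Kr Ur : Matrix (Fin N) (Fin N) ℂ} {σr δ : Fin N → ℝ} {q : ℝ} (hq : 0 < q)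
    (hσr : ∀ n, 0 ≤ σr n) (hδ : ∀ n, 0 < δ n)
    (hCr : Cr * Crᴴ = Zr) (hUr : Ur ∈ Matrix.unitaryGroup (Fin N) ℂ)
    (hZrU : Zr = Ur * Matrix.diagonal (fun n => (σr n : ℂ)) * Urᴴ)
    (hKrU : Kr = Ur * Matrix.diagonal (fun n => (δ n : ℂ)) * Urᴴ)
    (S : Matrix (Fin M) (Fin L) ℂ) :
    linkMSE Ct Cr (((q : ℂ) • (1 : Matrix (Fin L) (Fin L) ℂ)) ⊗ₖ Kr) S =
      ((∑ n, σr n * ((Zt⁻¹ + ((σr n / δ n / q : ℝ) : ℂ) •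
        (S.map star * Sᵀ))⁻¹).trace.re : ℝ) : ℂ) := by
  set X := S.map star * Sᵀ with hX
  have hXp : X.PosSemidef := posSemidef_map_star_mul_transpose S
  have hU : Urᴴ * Ur = 1 := mem_unitaryGroup_iff'.1 hUr
  have hU' : Ur * Urᴴ = 1 := mem_unitaryGroup_iff.1 hUr
  have hqC : (q : ℂ) ≠ 0 := by exact_mod_cast hq.ne'
  -- Eigenvalues of `(q Kr)⁻¹`, so that the coefficient of `X` in block `n` is `σr n * κ n`.
  set κ : Fin N → ℂ := fun n => ((1 / δ n / q : ℝ) : ℂ) with hκ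
  set Q : Matrix (Fin N) (Fin N) ℂ := Ur * Matrix.diagonal κ * Urᴴ with hQ
  have hQp : Q.PosSemidef := by
    have : (Matrix.diagonal κ).PosSemidef := posSemidef_diagonal_iff.2 fun n =>
       Complex.zero_le_real.2 (div_nonneg (div_nonneg zero_le_one (hδ n).le) hq.le)
    simpa [hQ] using this.conjTranspose_mul_mul_same Urᴴ
  have hKinv : (((q : ℂ) • (1 : Matrix (Fin L) (Fin L) ℂ)) ⊗ₖ Kr)⁻¹ =
      (1 : Matrix (Fin L) (Fin L) ℂ) ⊗ₖ Q := by
    refine inv_eq_right_inv ?_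
    have hd : (q : ℂ) • (Kr * Q) = 1 := by
      calc (q : ℂ) • (Kr * Q)
          = (q : ℂ) • (Ur * (Matrix.diagonal (fun n => (δ n : ℂ)) * (Urᴴ * Ur) *
              Matrix.diagonal κ) * Urᴴ) := by rw [hKrU, hQ]; simp only [Matrix.mul_assoc]
        _ = Ur * ((q : ℂ) • Matrix.diagonal (fun n => (δ n : ℂ) * κ n)) * Urᴴ := by
            rw [hU, Matrix.mul_one, diagonal_mul_diagonal]; simp
        _ = Ur * 1 * Urᴴ := by
            congr 2
            rw [← diagonal_smul, ← diagonal_one]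
            congr 1
            funext n
            have : (δ n : ℂ) ≠ 0 := by exact_mod_cast (hδ n).ne'
            simp only [hκ, Pi.smul_apply, smul_eq_mul]
            push_cast
            field_simp
        _ = 1 := by rw [Matrix.mul_one, hU']
    rw [smul_kronecker, smul_mul, ← mul_kronecker_mul, Matrix.one_mul, ← kronecker_smul, hd,
      one_kronecker_one]
  set P : Fin N → Matrix (Fin M) (Fin M) ℂ := fun n =>
    (Zt⁻¹ + ((σr n / δ n / q : ℝ) : ℂ) • X)⁻¹ with hP
  have hPD : ∀ n, (Zt⁻¹ + ((σr n / δ n / q : ℝ) : ℂ) • X).PosDef := fun n =>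
    posDef_inv_add_smul hZt (div_nonneg (div_nonneg (hσr n) (hδ n).le) hq.le) S
  -- Conjugation by `W` turns each Kronecker product with a matrix diagonal in the basis `Ur` into a
  -- block diagonal matrix indexed by `n`.
  set W : Matrix (Fin M × Fin N) (Fin M × Fin N) ℂ := (1 : Matrix (Fin M) (Fin M) ℂ) ⊗ₖ Ur with hW
  have hWW : Wᴴ * W = 1 := by
    rw [hW, conjTranspose_kronecker, ← mul_kronecker_mul, hU]; simp
  set D := blockDiagonal fun n => (σr n : ℂ) • P n with hD
  set A := blockDiagonal fun n => (σr n : ℂ) • Zt with hA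
  set B := blockDiagonal fun n => κ n • X with hB
  have hconj : ∀ (Y : Matrix (Fin M) (Fin M) ℂ) (d : Fin N → ℂ),
      Y ⊗ₖ (Ur * Matrix.diagonal d * Urᴴ) = W * (blockDiagonal fun n => d n • Y) * Wᴴ := by
    intro Y d
    have := kronecker_diagonal Y d
    simp only [op_smul_eq_smul] at this
    rw [hW, conjTranspose_kronecker, ← this, ← mul_kronecker_mul, ← mul_kronecker_mul]
    simp
  have hCC : (Ct ⊗ₖ Cr) * (Ct ⊗ₖ Cr)ᴴ = W * A * Wᴴ := by
    rw [conjTranspose_kronecker, ← mul_kronecker_mul, hCt, hCr, hZrU, hconj]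
  have hXQ : X ⊗ₖ Q = W * B * Wᴴ := hconj X κ
  -- Blockwise this is `Zt` times the defining equation of `P n`, scaled by `σr n`, which may
  -- vanish.
  have hABD : D + A * B * D = A := by
    rw [hA, hB, hD, ← blockDiagonal_mul, ← blockDiagonal_mul, ← blockDiagonal_add]
    congr 1
    funext n
    have h1 : Zt * Zt⁻¹ = 1 := mul_nonsing_inv _ ((isUnit_iff_isUnit_det _).1 hZt.isUnit)
    have h2 : (Zt⁻¹ + ((σr n / δ n / q : ℝ) : ℂ) • X) * P n = 1 :=
      mul_nonsing_inv _ ((isUnit_iff_isUnit_det _).1 (hPD n).isUnit)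
    have h3 : P n + ((σr n / δ n / q : ℝ) : ℂ) • (Zt * X * P n) = Zt := by
      calc _ = Zt * ((Zt⁻¹ + ((σr n / δ n / q : ℝ) : ℂ) • X) * P n) := by
            rw [Matrix.add_mul, Matrix.mul_add, ← Matrix.mul_assoc Zt Zt⁻¹, h1, Matrix.one_mul]
            simp only [Matrix.mul_assoc, Matrix.smul_mul, Matrix.mul_smul]
        _ = Zt := by rw [h2, Matrix.mul_one]
    have h4 : ((σr n / δ n / q : ℝ) : ℂ) = (σr n : ℂ) * κ n := by
      simp only [hκ]; push_cast; ring
    rw [h4] at h3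
    simp only [Pi.add_apply]
    conv_rhs => rw [← h3]
    simp only [Matrix.smul_mul, Matrix.mul_smul, smul_add, smul_smul]
    congr 2
    ring
  have hB' : ((Sᵀ * Ct) ⊗ₖ Cr)ᴴ * ((1 : Matrix (Fin L) (Fin L) ℂ) ⊗ₖ Q) * ((Sᵀ * Ct) ⊗ₖ Cr) =
      (Ct ⊗ₖ Cr)ᴴ * (X ⊗ₖ Q) * (Ct ⊗ₖ Cr) := by
    simp only [conjTranspose_kronecker, ← mul_kronecker_mul, conjTranspose_mul, Matrix.mul_one]
    congr 1
    rw [hX]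
    simp only [Matrix.mul_assoc]
    rfl
  have hR : (1 + (Ct ⊗ₖ Cr) * (Ct ⊗ₖ Cr)ᴴ * (X ⊗ₖ Q)) * (W * D * Wᴴ) =
      (Ct ⊗ₖ Cr) * (Ct ⊗ₖ Cr)ᴴ := by
    rw [hCC, hXQ]
    calc (1 + W * A * Wᴴ * (W * B * Wᴴ)) * (W * D * Wᴴ)
        = W * (D + A * (Wᴴ * W) * B * (Wᴴ * W) * D) * Wᴴ := by noncomm_ring
      _ = W * A * Wᴴ := by rw [hWW, Matrix.mul_one, Matrix.mul_one, hABD]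
  have hmain := trace_gram_mul_inv (hXp.kronecker hQp) hR
  rw [linkMSE, hKinv, hB', mul_kronecker_mul, ← conjTranspose_kronecker, hmain, trace_mul_comm,
    ← Matrix.mul_assoc, hWW, Matrix.one_mul, hD, trace_blockDiagonal]
  simp only [Complex.ofReal_sum, Complex.ofReal_mul]
  refine Finset.sum_congr rfl fun n _ => ?_
  rw [PosDef.ofReal_re_trace (hPD n).inv, trace_smul, smul_eq_mul]

end MSE

end RelayTraining

namespace RelayTraining

open Matrix

/-! ### Properties of the multiplier function -/

section Multiplier

variable {M : ℕ} {N : Fin 2 → ℕ} {σt : Fin M → ℝ} {σr β : (i : Fin 2) → Fin (N i) → ℝ}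

lemma multiplierBound_eq_iSup :
    multiplierBound σt σr β = ⨆ m, multiplierRHS σt σr β m 0 := by
  simp [multiplierBound, multiplierRHS]

lemma multiplierRHS_strictAntiOn (hσt : ∀ m, 0 < σt m) (hσr : ∀ i n, 0 ≤ σr i n)
    (hβ : ∀ i n, 0 ≤ β i n) (hpos : ∃ i n, 0 < σr i n ∧ 0 < β i n) (m : Fin M) :
    StrictAntiOn (multiplierRHS σt σr β m) (Set.Ici 0) := by
  intro x hx y hy hxy
  rw [Set.mem_Ici] at hx hy
  have ht := hσt m
  obtain ⟨i₀, n₀, hr₀, hb₀⟩ := hpos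
  have hle : ∀ i n, σr i n * β i n * σt m ^ 2 / (1 + β i n * σt m * y) ^ 2 ≤
      σr i n * β i n * σt m ^ 2 / (1 + β i n * σt m * x) ^ 2 := fun i n => by
    have := hσr i n
    have := hβ i n
    gcongr
  refine Finset.sum_lt_sum (fun i _ => Finset.sum_le_sum fun n _ => hle i n)
    ⟨i₀, Finset.mem_univ _, Finset.sum_lt_sum (fun n _ => hle i₀ n) ⟨n₀, Finset.mem_univ _, ?_⟩⟩
  gcongr

lemma multiplierRHS_pos (hσt : ∀ m, 0 < σt m) (hσr : ∀ i n, 0 ≤ σr i n)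
    (hβ : ∀ i n, 0 ≤ β i n) (hpos : ∃ i n, 0 < σr i n ∧ 0 < β i n) (m : Fin M) {x : ℝ}
    (hx : 0 ≤ x) : 0 < multiplierRHS σt σr β m x := by
  have ht := hσt m
  obtain ⟨i₀, n₀, hr₀, hb₀⟩ := hpos
  have hle : ∀ i n, 0 ≤ σr i n * β i n * σt m ^ 2 / (1 + β i n * σt m * x) ^ 2 := fun i n => by
    have := hσr i n
    have := hβ i n
    positivity
  refine Finset.sum_pos' (fun i _ => Finset.sum_nonneg fun n _ => hle i n)
    ⟨i₀, Finset.mem_univ _, Finset.sum_pos' (fun n _ => hle i₀ n) ⟨n₀, Finset.mem_univ _, ?_⟩⟩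
  positivity

lemma multiplierRHS_continuousOn (hσt : ∀ m, 0 < σt m) (hβ : ∀ i n, 0 ≤ β i n) (m : Fin M) :
    ContinuousOn (multiplierRHS σt σr β m) (Set.Ici 0) := by
  unfold multiplierRHS
  refine continuousOn_finsetSum _ fun i _ => continuousOn_finsetSum _ fun n _ => ?_
  refine ContinuousOn.div (by fun_prop) (by fun_prop) fun x hx => ?_
  rw [Set.mem_Ici] at hx
  have := hσt m
  have := hβ i n
  positivity

lemma multiplierRHS_tendsto (hσt : ∀ m, 0 < σt m) (hβ : ∀ i n, 0 ≤ β i n) (m : Fin M) :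
    Filter.Tendsto (multiplierRHS σt σr β m) Filter.atTop (nhds 0) := by
  have h : ∀ i n, Filter.Tendsto
      (fun x => σr i n * β i n * σt m ^ 2 / (1 + β i n * σt m * x) ^ 2) Filter.atTop (nhds 0) := by
    intro i n
    rcases (hβ i n).eq_or_lt with h0 | h0
    · simp [← h0]
    · refine Filter.Tendsto.const_div_atTop ?_ _
      refine (Filter.tendsto_pow_atTop two_ne_zero).comp ?_
      exact Filter.tendsto_atTop_add_const_left _ _
        (Filter.tendsto_id.const_mul_atTop (mul_pos h0 (hσt m)))
  have hsum := tendsto_finsetSum Finset.univ fun i _ =>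
    tendsto_finsetSum Finset.univ fun n _ => h i n
  simp only [Finset.sum_const_zero] at hsum
  exact hsum

lemma multiplierRHS_mono (hσt : ∀ m, 0 < σt m) (hσr : ∀ i n, 0 ≤ σr i n)
    (hβ : ∀ i n, 0 ≤ β i n) {m m' : Fin M} (hm : σt m ≤ σt m') {x : ℝ} (hx : 0 ≤ x) :
    multiplierRHS σt σr β m x ≤ multiplierRHS σt σr β m' x := by
  refine Finset.sum_le_sum fun i _ => Finset.sum_le_sum fun n _ => ?_
  have h1 := hσt m
  have h2 := hσt m'
  have h3 := hβ i n
  -- Each summand is a nonnegative constant times the square of `σ / (1 + β σ x)`, which increases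
  -- with `σ`.
  have h4 : σt m / (1 + β i n * σt m * x) ≤ σt m' / (1 + β i n * σt m' * x) := by
    rw [div_le_div_iff₀ (by positivity) (by positivity)]
    nlinarith
  calc σr i n * β i n * σt m ^ 2 / (1 + β i n * σt m * x) ^ 2
      = σr i n * β i n * (σt m / (1 + β i n * σt m * x)) ^ 2 := by rw [div_pow]; ring
    _ ≤ σr i n * β i n * (σt m' / (1 + β i n * σt m' * x)) ^ 2 := by
        have := hσr i n
        gcongr
    _ = _ := by rw [div_pow]; ring

end Multiplier

/-! ### Tangent bound for the trace of the inverse -/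

section TraceInverse

variable {m : Type*} [Fintype m] [DecidableEq m]

/-- With `C = diag(1 / b)`, the gap is the trace of `(A⁻¹ - C)ᴴ A (A⁻¹ - C)`, a positive
semidefinite matrix. Its vanishing forces `A⁻¹ = C` because `A` is definite. -/
lemma re_trace_inv_gap {A : Matrix m m ℂ} (hA : A.PosDef) {b : m → ℝ} (hb : ∀ i, 0 < b i) :
    0 ≤ A⁻¹.trace.re - ∑ i, (1 / b i - ((A i i).re - b i) / b i ^ 2) ∧
      (A⁻¹.trace.re - ∑ i, (1 / b i - ((A i i).re - b i) / b i ^ 2) = 0 →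
        A = Matrix.diagonal fun i => (b i : ℂ)) := by
  set C : Matrix m m ℂ := Matrix.diagonal fun i => ((b i)⁻¹ : ℂ) with hC
  have hCh : Cᴴ = C := by
    rw [hC, diagonal_conjTranspose]; congr 1; ext i; simp
  have hAh : (A⁻¹)ᴴ = A⁻¹ := hA.inv.isHermitian.eq
  have hAA : A⁻¹ * A = 1 := nonsing_inv_mul _ ((isUnit_iff_isUnit_det _).1 hA.isUnit)
  have hAA' : A * A⁻¹ = 1 := mul_nonsing_inv _ ((isUnit_iff_isUnit_det _).1 hA.isUnit)
  have hP : ((A⁻¹ - C)ᴴ * A * (A⁻¹ - C)).PosSemidef :=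
    hA.posSemidef.conjTranspose_mul_mul_same _
  have hexp : (A⁻¹ - C)ᴴ * A * (A⁻¹ - C) = A⁻¹ - C - C + C * A * C := by
    rw [conjTranspose_sub, hCh, hAh]
    calc (A⁻¹ - C) * A * (A⁻¹ - C) = (A⁻¹ * A) * A⁻¹ - (A⁻¹ * A) * C - C * (A * A⁻¹)
        + C * A * C := by noncomm_ring
      _ = _ := by rw [hAA, hAA']; simp
  have htr : ((A⁻¹ - C)ᴴ * A * (A⁻¹ - C)).trace.re =
      A⁻¹.trace.re - ∑ i, (1 / b i - ((A i i).re - b i) / b i ^ 2) := by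
    have hCAC : (C * A * C).trace.re = ∑ i, (A i i).re / b i ^ 2 := by
      simp only [trace, diag_apply, hC, diagonal_mul, mul_diagonal, Complex.re_sum]
      refine Finset.sum_congr rfl fun i _ => ?_
      rw [← Complex.ofReal_inv, mul_right_comm, ← Complex.ofReal_mul, Complex.re_ofReal_mul]
      field_simp
    have hCt : C.trace.re = ∑ i, 1 / b i := by
      simp only [trace, diag_apply, hC, diagonal_apply_eq, Complex.re_sum]
      refine Finset.sum_congr rfl fun i _ => ?_
      rw [← Complex.ofReal_inv, Complex.ofReal_re, one_div]
    rw [hexp, trace_add, trace_sub, trace_sub]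
    simp only [Complex.add_re, Complex.sub_re, hCAC, hCt]
    rw [sub_sub, ← Finset.sum_add_distrib, sub_add, ← Finset.sum_sub_distrib]
    congr 1
    refine Finset.sum_congr rfl fun i _ => ?_
    have := (hb i).ne'
    field_simp
    ring
  rw [← htr]
  refine ⟨(Complex.le_def.1 hP.trace_nonneg).1, fun h => ?_⟩
  have him : ((A⁻¹ - C)ᴴ * A * (A⁻¹ - C)).trace = 0 :=
    Complex.ext h (Complex.le_def.1 hP.trace_nonneg).2.symm
  have h0 := hP.trace_eq_zero_iff.1 him
  have hAC : A⁻¹ - C = 0 := by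
    by_contra hne
    obtain ⟨v, hv⟩ : ∃ v, (A⁻¹ - C) *ᵥ v ≠ 0 := by
      by_contra! hv
      exact hne (Matrix.ext_of_mulVec_single fun i => by rw [hv, zero_mulVec])
    have h1 := hA.dotProduct_mulVec_pos hv
    rw [star_mulVec, dotProduct_mulVec, vecMul_vecMul, ← dotProduct_mulVec, mulVec_mulVec, h0,
      zero_mulVec, dotProduct_zero] at h1
    exact h1.false
  have h2 : A * C = 1 := by rw [← sub_eq_zero.1 hAC, hAA']
  have h3 : C * (Matrix.diagonal fun i => (b i : ℂ)) = 1 := by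
    rw [hC, diagonal_mul_diagonal, ← diagonal_one]
    congr 1; ext i
    exact inv_mul_cancel₀ (by exact_mod_cast (hb i).ne')
  calc A = A * (C * Matrix.diagonal fun i => (b i : ℂ)) := by rw [h3, Matrix.mul_one]
    _ = _ := by rw [← Matrix.mul_assoc, h2, Matrix.one_mul]

lemma re_trace_inv_diagonal {b : m → ℝ} (hb : ∀ i, 0 < b i) :
    (Matrix.diagonal fun i => (b i : ℂ))⁻¹.trace.re = ∑ i, 1 / b i := by
  have h : (Matrix.diagonal fun i => (b i : ℂ))⁻¹ = Matrix.diagonal fun i => ((b i)⁻¹ : ℂ) := by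
    refine inv_eq_right_inv ?_
    rw [diagonal_mul_diagonal, ← diagonal_one]
    congr 1; ext i
    exact mul_inv_cancel₀ (by exact_mod_cast (hb i).ne')
  rw [h]
  simp only [trace, diag_apply, diagonal_apply_eq, Complex.re_sum]
  refine Finset.sum_congr rfl fun i _ => ?_
  rw [← Complex.ofReal_inv, Complex.ofReal_re, one_div]

end TraceInverse

/-! ### Factorizations of a diagonal Gram matrix -/

section SqrtDiag

variable {M L : ℕ} {s : Fin M → ℝ}

lemma sqrtDiag_mul_apply (hML : M ≤ L) {n : Type*} (B : Matrix (Fin L) n ℂ) (m : Fin M) (k : n) :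
    (sqrtDiag L s * B) m k = (Real.sqrt (s m) : ℂ) * B (Fin.castLE hML m) k := by
  rw [Matrix.mul_apply, Finset.sum_eq_single (Fin.castLE hML m)]
  · simp [sqrtDiag]
  · intro l _ hl
    have : (m : ℕ) ≠ l := fun h => hl (Fin.ext h.symm)
    simp [sqrtDiag, this]
  · simp

lemma sqrtDiag_mul_conjTranspose (hML : M ≤ L) (hs : ∀ m, 0 ≤ s m) :
    sqrtDiag L s * (sqrtDiag L s)ᴴ = Matrix.diagonal fun m => (s m : ℂ) := by
  ext m m'
  rw [sqrtDiag_mul_apply hML, conjTranspose_apply]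
  rcases eq_or_ne m m' with rfl | h
  · simp only [sqrtDiag, of_apply, Fin.val_castLE, if_true, diagonal_apply_eq, Complex.star_def,
      Complex.conj_ofReal]
    rw [← Complex.ofReal_mul, Real.mul_self_sqrt (hs m)]
  · have h' : (m' : ℕ) ≠ m := fun e => h (Fin.ext e.symm)
    simp [sqrtDiag, h, h']

/-- The rows of `Y` are orthogonal with squared norms `s m`. Normalized nonzero rows extend to an
orthonormal basis, which supplies `V`; the other rows vanish. -/
lemma mul_conjTranspose_eq_diagonal_iff (hML : M ≤ L) (hs : ∀ m, 0 ≤ s m)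
    (Y : Matrix (Fin M) (Fin L) ℂ) :
    Y * Yᴴ = (Matrix.diagonal fun m => (s m : ℂ)) ↔
      ∃ V ∈ Matrix.unitaryGroup (Fin L) ℂ, Y = sqrtDiag L s * Vᴴ := by
  constructor
  · intro h
    have hY : ∀ m m', ∑ k, Y m k * star (Y m' k) = if m = m' then (s m : ℂ) else 0 := by
      intro m m'
      have := congrFun (congrFun h m) m'
      rwa [Matrix.mul_apply, diagonal_apply] at this
    -- Only the values on `I` matter; elsewhere the basis extension is free to choose.
    set v : Fin L → EuclideanSpace ℂ (Fin L) := fun l =>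
      if hl : (l : ℕ) < M then WithLp.toLp 2 fun k => (Real.sqrt (s ⟨l, hl⟩) : ℂ)⁻¹ * Y ⟨l, hl⟩ k
      else 0 with hv
    set I : Set (Fin L) := {l | ∃ hl : (l : ℕ) < M, 0 < s ⟨l, hl⟩} with hI
    have hon : Orthonormal ℂ (I.domRestrict v) := by
      rw [orthonormal_iff_ite]
      rintro ⟨l, hl, hsl⟩ ⟨l', hl', hsl'⟩
      have hsq : (Real.sqrt (s ⟨l', hl'⟩) : ℂ) ≠ 0 := by
        exact_mod_cast (Real.sqrt_pos.2 hsl').ne'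
      have hsq2 : (Real.sqrt (s ⟨l', hl'⟩) : ℂ) * Real.sqrt (s ⟨l', hl'⟩) = s ⟨l', hl'⟩ := by
        rw [← Complex.ofReal_mul, Real.mul_self_sqrt hsl'.le]
      have hin : inner ℂ (v l) (v l') = (Real.sqrt (s ⟨l', hl'⟩) : ℂ)⁻¹ *
          (Real.sqrt (s ⟨l, hl⟩) : ℂ)⁻¹ * ∑ k, Y ⟨l', hl'⟩ k * star (Y ⟨l, hl⟩ k) := by
        simp only [hv, hl, hl', dif_pos, PiLp.inner_apply, RCLike.inner_apply, map_mul, map_inv₀,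
          Complex.conj_ofReal, Finset.mul_sum, Complex.star_def]
        exact Finset.sum_congr rfl fun k _ => by ring
      simp only [Set.domRestrict_apply, Subtype.mk.injEq]
      rw [hin, hY]
      rcases eq_or_ne l l' with rfl | hne
      · simp only [if_true]
        rw [← hsq2]
        field_simp
      · have hne' : (⟨l', hl'⟩ : Fin M) ≠ ⟨l, hl⟩ := fun e =>
          hne (Fin.ext (congrArg Fin.val e).symm)
        simp [hne, hne']
    obtain ⟨b, hb⟩ := hon.exists_orthonormalBasis_extension_of_card_eq (by simp)
    -- The conjugate makes row `l` of `Vᴴ` equal to `b l`.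
    refine ⟨Matrix.of fun k l => star (b l k), ?_, ?_⟩
    · rw [mem_unitaryGroup_iff']
      ext l l'
      have := orthonormal_iff_ite.1 b.orthonormal l' l
      rw [PiLp.inner_apply] at this
      simp only [RCLike.inner_apply] at this
      simpa [star_eq_conjTranspose, Matrix.mul_apply, Matrix.one_apply, eq_comm] using this
    · ext m k
      rw [sqrtDiag_mul_apply hML]
      simp only [conjTranspose_apply, of_apply, star_star]
      rcases (hs m).eq_or_lt with h0 | h0
      · have h1 := hY m m
        rw [if_pos rfl, ← h0] at h1
        have h2 : Y m = 0 := dotProduct_star_self_eq_zero.1 (by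
          rw [dotProduct_comm]; simpa [dotProduct] using h1)
        simp [← h0, h2]
      · rw [hb (Fin.castLE hML m) ⟨m.2, h0⟩]
        have hsq : (Real.sqrt (s m) : ℂ) ≠ 0 := by exact_mod_cast (Real.sqrt_pos.2 h0).ne'
        simp [hv, hsq]
  · rintro ⟨V, hV, rfl⟩
    have hV' : Vᴴ * V = 1 := mem_unitaryGroup_iff'.1 hV
    rw [conjTranspose_mul, conjTranspose_conjTranspose, Matrix.mul_assoc, ← Matrix.mul_assoc Vᴴ,
      hV', Matrix.one_mul, sqrtDiag_mul_conjTranspose hML hs]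

end SqrtDiag

end RelayTraining

namespace RelayTraining

open Matrix

/-! ### Optimal Gram matrices and training matrices -/

section Optimality

variable {M L : ℕ} {N : Fin 2 → ℕ}

/-- The objective in the eigenbasis of the transmit covariance, as a function of the Gram matrix
`X` of the training signal. -/
noncomputable def gramObjective (σt : Fin M → ℝ) (σr β : (i : Fin 2) → Fin (N i) → ℝ)
    (X : Matrix (Fin M) (Fin M) ℂ) : ℝ :=
  ∑ i, ∑ n, σr i n *
    ((Matrix.diagonal (fun m => ((1 / σt m : ℝ) : ℂ)) + (β i n : ℂ) • X)⁻¹).trace.re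

variable {σt : Fin M → ℝ} {σr β : (i : Fin 2) → Fin (N i) → ℝ}

/-- The objective difference is a weighted sum of tangent gaps minus a linear term, and
`multiplierRHS` at `s m` is minus the derivative in `X m m`. Water-filling bounds the linear term by
`lam * (Tr X - τ) ≤ 0`. -/
lemma gramObjective_gap (hσt : ∀ m, 0 < σt m) (hσr : ∀ i n, 0 ≤ σr i n)
    (hβ : ∀ i n, 0 ≤ β i n) (hpos : ∃ i n, 0 < σr i n ∧ 0 < β i n) {lam τ : ℝ} (hlam : 0 < lam)
    {s : Fin M → ℝ} (hs : IsWaterfilling (multiplierRHS σt σr β) lam s) (hsτ : ∑ m, s m = τ)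
    {X : Matrix (Fin M) (Fin M) ℂ} (hX : X.PosSemidef) (hXτ : X.trace.re ≤ τ) :
    gramObjective σt σr β (Matrix.diagonal fun m => (s m : ℂ)) ≤ gramObjective σt σr β X ∧
      (gramObjective σt σr β X ≤ gramObjective σt σr β (Matrix.diagonal fun m => (s m : ℂ)) →
        X = Matrix.diagonal fun m => (s m : ℂ)) := by
  have hs0 := hs.nonneg
  set b : (i : Fin 2) → Fin (N i) → Fin M → ℝ := fun i n m => 1 / σt m + β i n * s m with hb
  have hbpos : ∀ i n m, 0 < b i n m := fun i n m =>
    add_pos_of_pos_of_nonneg (one_div_pos.2 (hσt m)) (mul_nonneg (hβ i n) (hs0 m))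
  set A : (i : Fin 2) → Fin (N i) → Matrix (Fin M) (Fin M) ℂ := fun i n =>
    Matrix.diagonal (fun m => ((1 / σt m : ℝ) : ℂ)) + (β i n : ℂ) • X with hA
  have hApos : ∀ i n, (A i n).PosDef := fun i n =>
    (posDef_diagonal_iff.2 fun m => Complex.zero_lt_real.2 (one_div_pos.2 (hσt m))).add_posSemidef
      (hX.smul (Complex.zero_le_real.2 (hβ i n)))
  have hAre : ∀ i n m, (A i n m m).re - b i n m = β i n * ((X m m).re - s m) := fun i n m => by
    simp only [hA, hb, Matrix.add_apply, diagonal_apply_eq, Matrix.smul_apply, smul_eq_mul,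
      Complex.add_re, Complex.ofReal_re, Complex.re_ofReal_mul]
    ring
  set gap : (i : Fin 2) → Fin (N i) → ℝ := fun i n =>
    (A i n)⁻¹.trace.re - ∑ m, (1 / b i n m - ((A i n m m).re - b i n m) / b i n m ^ 2) with hgap
  have hgap0 : ∀ i n, 0 ≤ gap i n := fun i n => (re_trace_inv_gap (hApos i n) (hbpos i n)).1
  have hφ : ∀ m, multiplierRHS σt σr β m (s m) = ∑ i, ∑ n, σr i n * β i n / b i n m ^ 2 := by
    intro m
    refine Finset.sum_congr rfl fun i _ => Finset.sum_congr rfl fun n _ => ?_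
    have h1 := hσt m
    have h2 : 0 < 1 + β i n * σt m * s m := by
      have := mul_nonneg (mul_nonneg (hβ i n) h1.le) (hs0 m)
      linarith
    have h3 : b i n m = (1 + β i n * σt m * s m) / σt m := by
      simp only [hb]; field_simp
    rw [h3]
    field_simp
  have hdiag : gramObjective σt σr β (Matrix.diagonal fun m => (s m : ℂ)) =
      ∑ i, ∑ n, σr i n * ∑ m, 1 / b i n m := by
    refine Finset.sum_congr rfl fun i _ => Finset.sum_congr rfl fun n _ => ?_
    rw [← re_trace_inv_diagonal (hbpos i n)]
    congr 4
    rw [← diagonal_smul, diagonal_add]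
    congr 1; ext m
    simp [hb]
  have hkey : gramObjective σt σr β X - gramObjective σt σr β (Matrix.diagonal fun m => (s m : ℂ)) =
      ∑ i, ∑ n, σr i n * gap i n - ∑ m, multiplierRHS σt σr β m (s m) * ((X m m).re - s m) := by
    have hlin : ∑ m, multiplierRHS σt σr β m (s m) * ((X m m).re - s m) =
        ∑ i, ∑ n, σr i n * ∑ m, ((A i n m m).re - b i n m) / b i n m ^ 2 := by
      simp only [hφ, Finset.sum_mul, Finset.mul_sum]
      rw [Finset.sum_comm]
      refine Finset.sum_congr rfl fun i _ => ?_
      rw [Finset.sum_comm]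
      refine Finset.sum_congr rfl fun n _ => Finset.sum_congr rfl fun m _ => ?_
      rw [hAre]
      ring
    rw [hlin, hdiag, gramObjective, ← Finset.sum_sub_distrib, ← Finset.sum_sub_distrib]
    refine Finset.sum_congr rfl fun i _ => ?_
    rw [← Finset.sum_sub_distrib, ← Finset.sum_sub_distrib]
    refine Finset.sum_congr rfl fun n _ => ?_
    simp only [hgap, Finset.sum_sub_distrib]
    ring
  have hlin_le : ∑ m, multiplierRHS σt σr β m (s m) * ((X m m).re - s m) ≤ 0 := by
    calc _ ≤ ∑ m, lam * ((X m m).re - s m) := by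
          refine Finset.sum_le_sum fun m _ => ?_
          rw [mul_sub, mul_sub, hs.apply_mul m]
          -- For inactive directions the slope may be below `lam`; `X m m ≥ 0` settles the sign.
          exact sub_le_sub_right (mul_le_mul_of_nonneg_right (hs.apply_le m)
            (Complex.le_def.1 (hX.diag_nonneg (i := m))).1) _
      _ = lam * (X.trace.re - τ) := by
          rw [← Finset.mul_sum, Finset.sum_sub_distrib, hsτ, trace, Complex.re_sum]; rfl
      _ ≤ 0 := mul_nonpos_of_nonneg_of_nonpos hlam.le (by linarith)
  have hterm : ∀ i n, 0 ≤ σr i n * gap i n := fun i n => mul_nonneg (hσr i n) (hgap0 i n)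
  have hsum : 0 ≤ ∑ i, ∑ n, σr i n * gap i n :=
    Finset.sum_nonneg fun i _ => Finset.sum_nonneg fun n _ => hterm i n
  refine ⟨by linarith, fun hle => ?_⟩
  -- A single gap with positive weight and `β i n > 0` already determines `X`.
  obtain ⟨i, n, hr, hbn⟩ := hpos
  have hzero : ∑ i, ∑ n, σr i n * gap i n = 0 := by linarith
  have h1 := (Finset.sum_eq_zero_iff_of_nonneg fun i _ =>
    Finset.sum_nonneg fun n _ => hterm i n).1 hzero i (Finset.mem_univ i)
  have h2 := (Finset.sum_eq_zero_iff_of_nonneg fun n _ => hterm i n).1 h1 n (Finset.mem_univ n)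
  have h3 := (re_trace_inv_gap (hApos i n) (hbpos i n)).2
    ((mul_eq_zero.1 h2).resolve_left hr.ne')
  have hbC : (β i n : ℂ) ≠ 0 := by exact_mod_cast hbn.ne'
  ext m m'
  have h4 := congrFun (congrFun h3 m) m'
  rcases eq_or_ne m m' with rfl | hne
  · simp only [hA, hb, Matrix.add_apply, diagonal_apply_eq, Matrix.smul_apply, smul_eq_mul,
      Complex.ofReal_add, Complex.ofReal_mul] at h4 ⊢
    exact mul_left_cancel₀ hbC (add_left_cancel h4)
  · simpa [hA, hne, hbC] using h4

lemma objective_eq_gramObjective {Zt Ut : Matrix (Fin M) (Fin M) ℂ} (hσt : ∀ m, 0 < σt m)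
    (hUt : Ut ∈ Matrix.unitaryGroup (Fin M) ℂ)
    (hZtU : Zt = Ut * Matrix.diagonal (fun m => (σt m : ℂ)) * Utᴴ)
    (S : Matrix (Fin M) (Fin L) ℂ) :
    objective Zt σr β S =
      gramObjective σt σr β ((Utᴴ * S.map star) * (Utᴴ * S.map star)ᴴ) := by
  have hU : Utᴴ * Ut = 1 := mem_unitaryGroup_iff'.1 hUt
  have hU' : Ut * Utᴴ = 1 := mem_unitaryGroup_iff.1 hUt
  have hinv : Zt⁻¹ = Ut * Matrix.diagonal (fun m => ((1 / σt m : ℝ) : ℂ)) * Utᴴ := by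
    refine inv_eq_right_inv ?_
    calc _ = Ut * (Matrix.diagonal (fun m => (σt m : ℂ)) * (Utᴴ * Ut) *
          Matrix.diagonal (fun m => ((1 / σt m : ℝ) : ℂ))) * Utᴴ := by
            rw [hZtU]; simp only [Matrix.mul_assoc]
      _ = Ut * 1 * Utᴴ := by
          rw [hU, Matrix.mul_one, diagonal_mul_diagonal, ← diagonal_one]
          congr 3; ext m
          have : (σt m : ℂ) ≠ 0 := by exact_mod_cast (hσt m).ne'
          push_cast
          field_simp
      _ = 1 := by rw [Matrix.mul_one, hU']
  have hUi : Ut⁻¹ = Utᴴ := inv_eq_right_inv hU'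
  have hUi' : (Utᴴ)⁻¹ = Ut := inv_eq_right_inv hU
  refine Finset.sum_congr rfl fun i _ => Finset.sum_congr rfl fun n _ => ?_
  have hconj : Zt⁻¹ + (β i n : ℂ) • (S.map star * Sᵀ) =
      Ut * (Matrix.diagonal (fun m => ((1 / σt m : ℝ) : ℂ)) + (β i n : ℂ) •
        ((Utᴴ * S.map star) * (Utᴴ * S.map star)ᴴ)) * Utᴴ := by
    have hS : (S.map star)ᴴ = Sᵀ := by ext; simp
    rw [hinv, Matrix.mul_add, Matrix.add_mul, conjTranspose_mul, hS, conjTranspose_conjTranspose]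
    congr 1
    rw [Matrix.mul_smul, Matrix.smul_mul]
    congr 1
    calc S.map star * Sᵀ = (Ut * Utᴴ) * (S.map star * Sᵀ) * (Ut * Utᴴ) := by
          rw [hU', Matrix.one_mul, Matrix.mul_one]
      _ = _ := by simp only [Matrix.mul_assoc]
  rw [hconj, Matrix.mul_inv_rev, Matrix.mul_inv_rev, hUi, hUi', trace_mul_comm, Matrix.mul_assoc, hU,
    Matrix.mul_one]

lemma power_eq_trace {Ut : Matrix (Fin M) (Fin M) ℂ} (hUt : Ut ∈ Matrix.unitaryGroup (Fin M) ℂ)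
    (S : Matrix (Fin M) (Fin L) ℂ) :
    power S = ((Utᴴ * S.map star) * (Utᴴ * S.map star)ᴴ).trace.re := by
  have hU' : Ut * Utᴴ = 1 := mem_unitaryGroup_iff.1 hUt
  have hS : (S.map star)ᴴ = Sᵀ := by ext; simp
  have hT : (S * Sᴴ)ᵀ = S.map star * Sᵀ := by rw [transpose_mul]; rfl
  rw [conjTranspose_mul, conjTranspose_conjTranspose, trace_mul_comm, Matrix.mul_assoc,
    ← Matrix.mul_assoc Ut, hU', Matrix.one_mul, trace_mul_comm, hS, ← hT, trace_transpose, power]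

/-- The Gram variable is built from the conjugate of `S`; conjugating entrywise fixes the real
`sqrtDiag` and turns `Vᵀ` into `Vᴴ`. -/
lemma eq_map_star_mul_iff {Ut : Matrix (Fin M) (Fin M) ℂ}
    (hUt : Ut ∈ Matrix.unitaryGroup (Fin M) ℂ) (s : Fin M → ℝ) (S : Matrix (Fin M) (Fin L) ℂ)
    (V : Matrix (Fin L) (Fin L) ℂ) :
    S = Ut.map star * sqrtDiag L s * Vᵀ ↔ Utᴴ * S.map star = sqrtDiag L s * Vᴴ := by
  have hU : Utᴴ * Ut = 1 := mem_unitaryGroup_iff'.1 hUt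
  have hU' : Ut * Utᴴ = 1 := mem_unitaryGroup_iff.1 hUt
  have hmap : ∀ {a b c : ℕ} (A : Matrix (Fin a) (Fin b) ℂ) (B : Matrix (Fin b) (Fin c) ℂ),
      (A * B).map star = A.map star * B.map star := fun A B =>
    Matrix.map_mul (f := starRingEnd ℂ)
  have hss : ∀ {a b : ℕ} (A : Matrix (Fin a) (Fin b) ℂ), (A.map star).map star = A := fun A => by
    ext; simp
  have hsq : (sqrtDiag L s).map star = sqrtDiag L s := by
    ext m l
    simp only [sqrtDiag, map_apply, of_apply]
    split_ifs <;> simp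
  have hVt : Vᵀ.map star = Vᴴ := rfl
  constructor
  · rintro rfl
    rw [hmap, hmap, hss, hsq, hVt, ← Matrix.mul_assoc, ← Matrix.mul_assoc, hU, Matrix.one_mul]
  · intro h
    have h1 : S.map star = Ut * (sqrtDiag L s * Vᴴ) := by
      rw [← h, ← Matrix.mul_assoc, hU', Matrix.one_mul]
    rw [← hss S, h1, hmap, hmap, hsq, ← hVt, hss, Matrix.mul_assoc]

lemma isOptimalTraining_iff {Zt Ut : Matrix (Fin M) (Fin M) ℂ} (hML : M ≤ L)
    (hσt : ∀ m, 0 < σt m) (hUt : Ut ∈ Matrix.unitaryGroup (Fin M) ℂ)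
    (hZtU : Zt = Ut * Matrix.diagonal (fun m => (σt m : ℂ)) * Utᴴ)
    (hσr : ∀ i n, 0 ≤ σr i n) (hβ : ∀ i n, 0 ≤ β i n)
    (hpos : ∃ i n, 0 < σr i n ∧ 0 < β i n) {lam τ : ℝ} (hlam : 0 < lam)
    {s : Fin M → ℝ} (hs : IsWaterfilling (multiplierRHS σt σr β) lam s) (hsτ : ∑ m, s m = τ)
    (S : Matrix (Fin M) (Fin L) ℂ) :
    IsOptimalTraining (objective Zt σr β) τ S ↔
      ∃ V ∈ Matrix.unitaryGroup (Fin L) ℂ, S = Ut.map star * sqrtDiag L s * Vᵀ := by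
  simp only [eq_map_star_mul_iff hUt]
  rw [← mul_conjTranspose_eq_diagonal_iff hML hs.nonneg]
  have hgap : ∀ T : Matrix (Fin M) (Fin L) ℂ, power T ≤ τ → _ := fun T hT =>
    gramObjective_gap hσt hσr hβ hpos hlam hs hsτ
      (posSemidef_self_mul_conjTranspose (Utᴴ * T.map star)) (power_eq_trace hUt T ▸ hT)
  have hdiag : (Matrix.diagonal fun m => (s m : ℂ)).trace.re = τ := by
    simp [trace, ← hsτ]
  constructor
  · rintro ⟨hp, hopt⟩
    refine (hgap S hp).2 ?_
    -- The choice `V = 1` is a feasible competitor with Gram matrix `diag s`.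
    have h₀ := (eq_map_star_mul_iff hUt s
      (Ut.map star * sqrtDiag L s * (1 : Matrix (Fin L) (Fin L) ℂ)ᵀ) 1).1 rfl
    rw [conjTranspose_one, Matrix.mul_one] at h₀
    have h := hopt (Ut.map star * sqrtDiag L s * (1 : Matrix (Fin L) (Fin L) ℂ)ᵀ) (by
      rw [power_eq_trace hUt, h₀, sqrtDiag_mul_conjTranspose hML hs.nonneg, hdiag])
    rwa [objective_eq_gramObjective hσt hUt hZtU, objective_eq_gramObjective hσt hUt hZtU, h₀,
      sqrtDiag_mul_conjTranspose hML hs.nonneg] at h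
  · intro h
    refine ⟨by rw [power_eq_trace hUt, h, hdiag], fun T hT => ?_⟩
    rw [objective_eq_gramObjective hσt hUt hZtU, objective_eq_gramObjective hσt hUt hZtU, h]
    exact (hgap T hT).1

end Optimality

lemma posSemidef_of_unitary_conj {n : ℕ} {Z U D : Matrix (Fin n) (Fin n) ℂ} (hZ : Z.PosSemidef)
    (hU : U ∈ Matrix.unitaryGroup (Fin n) ℂ) (h : Z = U * D * Uᴴ) : D.PosSemidef := by
  have hUU : Uᴴ * U = 1 := mem_unitaryGroup_iff'.1 hU
  have := hZ.conjTranspose_mul_mul_same U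
  rwa [h, show Uᴴ * (U * D * Uᴴ) * U = (Uᴴ * U) * D * (Uᴴ * U) by noncomm_ring, hUU,
    Matrix.one_mul, Matrix.mul_one] at this

lemma posDef_of_unitary_conj {n : ℕ} {Z U D : Matrix (Fin n) (Fin n) ℂ} (hZ : Z.PosDef)
    (hU : U ∈ Matrix.unitaryGroup (Fin n) ℂ) (h : Z = U * D * Uᴴ) : D.PosDef := by
  have hUU : Uᴴ * U = 1 := mem_unitaryGroup_iff'.1 hU
  have hUu : IsUnit U := (Unitary.toUnits ⟨U, hU⟩).isUnit
  have := (hUu.posDef_star_left_conjugate_iff).2 hZ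
  rwa [star_eq_conjTranspose, h, show Uᴴ * (U * D * Uᴴ) * U = (Uᴴ * U) * D * (Uᴴ * U) by
    noncomm_ring, hUU, Matrix.one_mul, Matrix.mul_one] at this

end RelayTraining

/-! ### Assembly of the theorem -/

theorem lemma6 {M L : ℕ} {N : Fin 2 → ℕ} (hM : 0 < M) (hML : M ≤ L)
    -- transmit covariance of the relay, its factor and its eigendecomposition
    (Zt Ct Ut : Matrix (Fin M) (Fin M) ℂ) (σt : Fin M → ℝ)
    (hZt : Zt.PosDef) (hCt : Ct * Ctᴴ = Zt)
    (hUt : Ut ∈ Matrix.unitaryGroup (Fin M) ℂ)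
    (hZtU : Zt = Ut * Matrix.diagonal (fun m => (σt m : ℂ)) * Utᴴ)
    -- receive covariances of the two channels and spatial covariances of the disturbances,
    -- with common eigenvectors
    (Zr Cr Kr Ur : (i : Fin 2) → Matrix (Fin (N i)) (Fin (N i)) ℂ)
    (σr δ : (i : Fin 2) → Fin (N i) → ℝ)
    (hZr : ∀ i, (Zr i).PosSemidef) (hZr0 : ∃ i, Zr i ≠ 0)
    (hCr : ∀ i, Cr i * (Cr i)ᴴ = Zr i) (hKr : ∀ i, (Kr i).PosDef)
    (hUr : ∀ i, Ur i ∈ Matrix.unitaryGroup (Fin (N i)) ℂ)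
    (hZrU : ∀ i, Zr i = Ur i * Matrix.diagonal (fun n => (σr i n : ℂ)) * (Ur i)ᴴ)
    (hKrU : ∀ i, Kr i = Ur i * Matrix.diagonal (fun n => (δ i n : ℂ)) * (Ur i)ᴴ)
    -- temporal covariances `q_i I`
    (Kq : Fin 2 → Matrix (Fin L) (Fin L) ℂ) (q : Fin 2 → ℝ) (hq : ∀ i, 0 < q i)
    (hKq : ∀ i, Kq i = (q i : ℂ) • (1 : Matrix (Fin L) (Fin L) ℂ))
    -- relay power
    (τ : ℝ) (hτ : 0 < τ)
    -- coefficients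
    (β : (i : Fin 2) → Fin (N i) → ℝ) (hβ : β = RelayTraining.betaTilde σr δ q) :
    -- the total mean-square error is the objective below
    (∀ S : Matrix (Fin M) (Fin L) ℂ,
      ∑ i, RelayTraining.linkMSE Ct (Cr i) (Kq i ⊗ₖ Kr i) S =
        (RelayTraining.objective Zt σr β S : ℂ)) ∧
    ∃ p : ℝ → Fin M → ℝ,
      -- the multiplier equation determines the powers for every multiplier in the interval
      (∀ lam ∈ Set.Ioo 0 (RelayTraining.multiplierBound σt σr β), ∀ s : Fin M → ℝ,
        RelayTraining.IsAllocation σt σr β lam s ↔ s = p lam) ∧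
      -- the total power decreases with the multiplier
      StrictAntiOn (fun lam => ∑ m, p lam m)
        (Set.Ioo 0 (RelayTraining.multiplierBound σt σr β)) ∧
      ∃ lam ∈ Set.Ioo 0 (RelayTraining.multiplierBound σt σr β),
        -- the power constraint is met with equality
        ∑ m, p lam m = τ ∧
        -- bisection brackets the multiplier in intervals of length tending to zero
        (∀ k : ℕ,
          (RelayTraining.bisection (fun x => ∑ m, p x m) τ
            (RelayTraining.multiplierBound σt σr β) k).1 ≤ lam ∧
          lam ≤ (RelayTraining.bisection (fun x => ∑ m, p x m) τ
            (RelayTraining.multiplierBound σt σr β) k).2 ∧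
          (RelayTraining.bisection (fun x => ∑ m, p x m) τ
            (RelayTraining.multiplierBound σt σr β) k).2 -
          (RelayTraining.bisection (fun x => ∑ m, p x m) τ
            (RelayTraining.multiplierBound σt σr β) k).1 =
              RelayTraining.multiplierBound σt σr β / 2 ^ k) ∧
        -- the diagonal entries are ordered like the eigenvalues
        (∀ m m' : Fin M, σt m ≤ σt m' → p lam m ≤ p lam m') ∧
        -- the optimal training matrices are those of the stated form, with any unitary `V`
        ∀ S : Matrix (Fin M) (Fin L) ℂ,
          RelayTraining.IsOptimalTraining (RelayTraining.objective Zt σr β) τ S ↔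
            ∃ V ∈ Matrix.unitaryGroup (Fin L) ℂ,
              S = Ut.map star * RelayTraining.sqrtDiag L (p lam) * Vᵀ := by
  have hσt : ∀ m, 0 < σt m := fun m => Complex.zero_lt_real.1
    (Matrix.posDef_diagonal_iff.1 (RelayTraining.posDef_of_unitary_conj hZt hUt hZtU) m)
  have hσr : ∀ i n, 0 ≤ σr i n := fun i n => Complex.zero_le_real.1
    (Matrix.posSemidef_diagonal_iff.1
      (RelayTraining.posSemidef_of_unitary_conj (hZr i) (hUr i) (hZrU i)) n)
  have hδ : ∀ i n, 0 < δ i n := fun i n => Complex.zero_lt_real.1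
    (Matrix.posDef_diagonal_iff.1
      (RelayTraining.posDef_of_unitary_conj (hKr i) (hUr i) (hKrU i)) n)
  subst hβ
  set β := RelayTraining.betaTilde σr δ q with hβ
  have hβ0 : ∀ i n, 0 ≤ β i n := fun i n =>
    div_nonneg (div_nonneg (hσr i n) (hδ i n).le) (hq i).le
  have hpos : ∃ i n, 0 < σr i n ∧ 0 < β i n := by
    obtain ⟨i, hi⟩ := hZr0
    obtain ⟨n, hn⟩ : ∃ n, σr i n ≠ 0 := by
      by_contra! h0
      exact hi (by rw [hZrU i]; simp [h0])
    have hr := (hσr i n).lt_of_ne hn.symm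
    exact ⟨i, n, hr, div_pos (div_pos hr (hδ i n)) (hq i)⟩
  have hanti := RelayTraining.multiplierRHS_strictAntiOn hσt hσr hβ0 hpos
  have hcont := RelayTraining.multiplierRHS_continuousOn (σr := σr) hσt hβ0
  have htend := RelayTraining.multiplierRHS_tendsto (σr := σr) hσt hβ0
  have : Nonempty (Fin M) := ⟨⟨0, hM⟩⟩
  refine ⟨fun S => ?_, ?_⟩
  · rw [RelayTraining.objective, Complex.ofReal_sum]
    refine Finset.sum_congr rfl fun i _ => ?_
    rw [hKq i]
    exact RelayTraining.linkMSE_eq hZt hCt (hq i) (hσr i) (hδ i) (hCr i) (hUr i) (hZrU i)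
      (hKrU i) S
  -- Water-filling is solvable only for a positive level in general; at other levels `p` takes the
  -- default value `0`.
  have hex : ∀ lam : ℝ, ∃ s, 0 < lam →
      RelayTraining.IsWaterfilling (RelayTraining.multiplierRHS σt σr β) lam s := fun lam => by
    by_cases h : 0 < lam
    · obtain ⟨s, hs⟩ := RelayTraining.exists_isWaterfilling hcont htend h
      exact ⟨s, fun _ => hs⟩
    · exact ⟨0, fun h' => absurd h' h⟩
  choose p hp using hex
  have hmono := RelayTraining.strictAntiOn_sum_waterfilling hanti hp
  obtain ⟨lam, hlam, hsum⟩ := RelayTraining.exists_sum_waterfilling_eq hanti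
    (fun m _ hx => RelayTraining.multiplierRHS_pos hσt hσr hβ0 hpos m hx) hp hτ
  rw [← RelayTraining.multiplierBound_eq_iSup] at hmono hlam
  -- `IsAllocation` unfolds to `IsWaterfilling` for `multiplierRHS`, so the general results apply by
  -- definition.
  refine ⟨p, fun l hl s => ⟨fun h => RelayTraining.IsWaterfilling.unique hanti h (hp l hl.1), ?_⟩,
    hmono, lam, hlam, hsum, fun k => ?_, fun m m' hm => ?_, fun S => ?_⟩
  · rintro rfl
    exact hp l hl.1
  · exact (RelayTraining.bisection_spec hmono hlam hsum k).2.2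
  · exact (hp lam hlam.1).le_of_forall_le hanti fun x hx =>
      RelayTraining.multiplierRHS_mono hσt hσr hβ0 hm hx
  · exact RelayTraining.isOptimalTraining_iff hML hσt hUt hZtU hσr hβ0 hpos hlam.1
      (hp lam hlam.1) hsum S
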